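/- Let $d>2$ be an integer. Let $\mathbb{E}^d$ be the $d$-dimensional Euclidean space and let $\mathbb{S}^d=\{y\in\mathbb{E}^{d+1}:\langle y,y\rangle=1\}$. The open hemisphere of $\mathbb{S}^d$ with center $c\in\mathbb{S}^d$ is $\{y\in\mathbb{S}^d:\langle c,y\rangle>0\}$. A set $C\subseteq\mathbb{S}^d$ is spherically convex if it is contained in an open hemisphere and contains, with any two of its points, the shorter great circle arc (spherical segment) connecting them. A convex polytope in $\mathbb{E}^d$ is the convex hull of a finite set, with nonempty interior. A convex polytope in $\mathbb{S}^d$ is a compact spherically convex set with nonempty interior that is the spherical convex hull of a finite set, i.e. the intersection of all spherically convex sets containing that finite set. A face of a convex polytope $P$ is a convex (respectively spherically convex) subset $F\subseteq P$ such that every segment (respectively spherical segment) of $P$ whose relative interior meets $F$ is contained in $F$; it is proper if $F\neq P$. An exposed face of $P$ is the intersection of $P$ with a supporting $(d-1)$-dimensional great sphere (respectively supporting hyperplane) of $P$. Then for every convex polytope $P$ in $\mathbb{S}^d$ (respectively $\mathbb{E}^d$) there exist a point $x$ in the interior of $P$ and $d+1$ distinct open hemispheres of $\mathbb{S}^d$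 (respectively open half-spaces of $\mathbb{E}^d$), each having $x$ on its boundary, such that every exposed face of $P$, and likewise every proper face of $P$, is contained in at least one of these $d+1$ open hemispheres (respectively open half-spaces). -/

import Mathlib

/-- The `d`-dimensional Euclidean space. -/
abbrev Euc (d : ℕ) : Type := EuclideanSpace ℝ (Fin d)

/-- The `d`-dimensional spherical space: the unit sphere of the `(d+1)`-dimensional
Euclidean space centered at the origin (with the subspace topology). -/
abbrev Sph (d : ℕ) : Type := Metric.sphere (0 : Euc (d + 1)) 1

/-! ### Euclidean notions -/

section Euclidean

/-- Open half-spaces; the normal vector must be nonzero. -/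
def IsOpenHalfspace {d : ℕ} (H : Set (Euc d)) : Prop :=
  ∃ (u : Euc d) (t : ℝ), u ≠ 0 ∧ H = {y | t < inner ℝ u y}

/-- Convex polytopes: convex hulls of finite sets, with nonempty interior. -/
def IsConvexPolytope {d : ℕ} (P : Set (Euc d)) : Prop :=
  (∃ V : Set (Euc d), V.Finite ∧ P = convexHull ℝ V) ∧ (interior P).Nonempty

/-- `F` is a face of `K`: a convex subset of `K` containing every segment of `K` whose
relative interior meets `F`. -/
def IsFace {d : ℕ} (K F : Set (Euc d)) : Prop :=
  F ⊆ K ∧ Convex ℝ F ∧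
    ∀ p ∈ K, ∀ q ∈ K, (openSegment ℝ p q ∩ F).Nonempty → segment ℝ p q ⊆ F

/-- `F` is an exposed face of `K`: the intersection of `K` with a supporting hyperplane
`{y | ⟪u, y⟫ = t}` of `K`. -/
def IsExposedFace {d : ℕ} (K F : Set (Euc d)) : Prop :=
  ∃ (u : Euc d) (t : ℝ), u ≠ 0 ∧ (∀ y ∈ K, inner ℝ u y ≤ t) ∧ (∃ y ∈ K, inner ℝ u y = t) ∧
    F = {y | y ∈ K ∧ inner ℝ u y = t}

end Euclidean

/-! ### Spherical notions -/

section Spherical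

/-- The open hemisphere with center `c`. -/
def openHemisphere {d : ℕ} (c : Sph d) : Set (Sph d) :=
  {y | 0 < inner ℝ (c : Euc (d + 1)) (y : Euc (d + 1))}

/-- The spherical segment (shorter great circle arc) with endpoints `p`, `q`, for `q ≠ -p`:
the unit vectors that are nonnegative combinations of `p` and `q`. -/
def sphericalSegment {d : ℕ} (p q : Sph d) : Set (Sph d) :=
  {y | ∃ a b : ℝ, 0 ≤ a ∧ 0 ≤ b ∧
    (y : Euc (d + 1)) = a • (p : Euc (d + 1)) + b • (q : Euc (d + 1))}

/-- The relative interior of the spherical segment with endpoints `p`, `q`, for `q ≠ -p`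
(it is `{p}` if `p = q`). -/
def openSphericalSegment {d : ℕ} (p q : Sph d) : Set (Sph d) :=
  {y | ∃ a b : ℝ, 0 < a ∧ 0 < b ∧
    (y : Euc (d + 1)) = a • (p : Euc (d + 1)) + b • (q : Euc (d + 1))}

/-- Spherically convex sets: contained in an open hemisphere, and closed under spherical
segments (two points of an open hemisphere are never antipodal). -/
def SphericallyConvex {d : ℕ} (C : Set (Sph d)) : Prop :=
  (∃ c : Sph d, C ⊆ openHemisphere c) ∧ ∀ p ∈ C, ∀ q ∈ C, sphericalSegment p q ⊆ C

/-- Convex bodies of the sphere. -/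
def IsSphericalConvexBody {d : ℕ} (K : Set (Sph d)) : Prop :=
  IsCompact K ∧ SphericallyConvex K ∧ (interior K).Nonempty

/-- The spherical convex hull of `V`: the intersection of all spherically convex sets
containing `V`. It is meaningful only if `V` lies in an open hemisphere; otherwise it is the
whole sphere, which is not spherically convex. -/
def sphericalHull {d : ℕ} (V : Set (Sph d)) : Set (Sph d) :=
  ⋂₀ {C | SphericallyConvex C ∧ V ⊆ C}

/-- Convex polytopes of the sphere: convex bodies that are spherical convex hulls of finite
sets. -/
def IsSphericalConvexPolytope {d : ℕ} (P : Set (Sph d)) : Prop :=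
  IsSphericalConvexBody P ∧ ∃ V : Set (Sph d), V.Finite ∧ P = sphericalHull V

/-- `F` is a face of `K`: a spherically convex subset of `K` containing every spherical
segment of `K` whose relative interior meets `F`. -/
def IsSphericalFace {d : ℕ} (K F : Set (Sph d)) : Prop :=
  F ⊆ K ∧ SphericallyConvex F ∧
    ∀ p ∈ K, ∀ q ∈ K, (openSphericalSegment p q ∩ F).Nonempty → sphericalSegment p q ⊆ F

/-- `F` is an exposed face of `K`: the intersection of `K` with a supporting
`(d-1)`-dimensional greatsphere `{y | ⟪c, y⟫ = 0}` of `K`. -/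
def IsSphericalExposedFace {d : ℕ} (K F : Set (Sph d)) : Prop :=
  ∃ c : Sph d, (∀ y ∈ K, inner ℝ (c : Euc (d + 1)) (y : Euc (d + 1)) ≤ 0) ∧
    (∃ y ∈ K, inner ℝ (c : Euc (d + 1)) (y : Euc (d + 1)) = 0) ∧
    F = {y | y ∈ K ∧ inner ℝ (c : Euc (d + 1)) (y : Euc (d + 1)) = 0}

end Spherical

/-! ### Finitely generated pointed cones and the inductive construction. -/

section Core

open Module Filter Topology

variable {W : Type*} [AddCommGroup W] [Module ℝ W] [FiniteDimensional ℝ W]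

/-! Both geometries reduce to linear algebra on a cone with finite generating set `V` on which some
functional `c` is positive: the sphere directly, Euclidean space by placing the polytope at height 1
in one more dimension. Half-spaces through `x` become functionals vanishing at `x`, and every
exposed or nonempty proper face lies in the kernel of a nonzero functional `n` nonnegative on `V`.

`exists_functionals` then works by induction on dimension. Fix a facet `n₀ = 0` and take the point
`x'` and the functionals `f'` of that facet. Push `x'` slightly inside the cone to `x`. A new
functional through `x`, equal to `c` on the facet, handles all faces inside the facet. Any other
face meets the facet in a proper face of the facet, where some `f' i` is positive. Adding a large
multiple of `n₀` makes it positive at the generators off the facet, and subtracting a small multiple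
of `c` makes it vanish at `x`. Only finitely many strict inequalities are at stake, so they survive
when `x` is close to `x'`. Each dimension costs one more functional.

Facets exist by tilting a supporting functional (`exists_tilt`). Hahn-Banach places proper faces in
supporting hyperplanes (`exists_le_of_disjoint_interior`). -/

omit [FiniteDimensional ℝ W] in
theorem span_le_ker_of_forall_eq_zero {V : Set W} {n : Dual ℝ W} (h : ∀ v ∈ V, n v = 0) :
    Submodule.span ℝ V ≤ LinearMap.ker n :=
  Submodule.span_le.2 fun v hv => LinearMap.mem_ker.2 (h v hv)

/-- The counting device for faces: a functional that vanishes on the smaller set but not on the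
larger one forces a jump in dimension. -/
theorem finrank_span_lt_of_mem {A B : Set W} (hAB : A ⊆ B) {n : Dual ℝ W}
    (hA : ∀ v ∈ A, n v = 0) {w : W} (hw : w ∈ B) (hnw : n w ≠ 0) :
    finrank ℝ (Submodule.span ℝ A) < finrank ℝ (Submodule.span ℝ B) := by
  apply Submodule.finrank_lt_finrank_of_lt
  refine lt_of_le_of_ne (Submodule.span_mono hAB) fun h => hnw ?_
  have : w ∈ Submodule.span ℝ A := h ▸ Submodule.subset_span hw
  exact LinearMap.mem_ker.1 (span_le_ker_of_forall_eq_zero hA this)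

/-- A nonnegative functional whose zero set spans too little can be tilted to vanish on more. -/
theorem exists_tilt (V : Finset W) {n : Dual ℝ W} (hn : ∀ v ∈ V, 0 ≤ n v) {v₀ : W}
    (hnv₀ : 0 < n v₀)
    (hlt : finrank ℝ (Submodule.span ℝ {v | v ∈ V ∧ n v = 0}) + 1 <
      finrank ℝ (Submodule.span ℝ (V : Set W))) :
    ∃ n' : Dual ℝ W, (∀ v ∈ V, 0 ≤ n' v) ∧ 0 < n' v₀ ∧
      finrank ℝ (Submodule.span ℝ {v | v ∈ V ∧ n v = 0}) <
        finrank ℝ (Submodule.span ℝ {v | v ∈ V ∧ n' v = 0}) := by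
  set S := Submodule.span ℝ {v | v ∈ V ∧ n v = 0} with hS
  obtain ⟨v₁, hv₁, hv₁S⟩ : ∃ v₁ ∈ V, v₁ ∉ S ⊔ Submodule.span ℝ {v₀} := by
    by_contra! h
    have h1 : Submodule.span ℝ (V : Set W) ≤ S ⊔ Submodule.span ℝ {v₀} :=
      Submodule.span_le.2 fun v hv => h v hv
    have h2 := Submodule.finrank_mono h1
    have h3 := Submodule.finrank_add_le_finrank_add_finrank S (Submodule.span ℝ {v₀})
    have h4 := finrank_span_le_card (R := ℝ) ({v₀} : Set W)
    simp at h4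
    omega
  obtain ⟨m, hm, hmS⟩ := Submodule.exists_le_ker_of_notMem hv₁S
  obtain ⟨m, hm, hmS⟩ : ∃ m : Dual ℝ W, m v₁ < 0 ∧ S ⊔ Submodule.span ℝ {v₀} ≤ LinearMap.ker m := by
    rcases lt_or_gt_of_ne hm with h | h
    · exact ⟨m, h, hmS⟩
    · refine ⟨-m, by simpa using h, fun y hy => ?_⟩
      have := hmS hy
      simpa using this
  have hm0 : m v₀ = 0 := LinearMap.mem_ker.1
    (hmS (Submodule.mem_sup_right (Submodule.mem_span_singleton_self v₀)))
  have hmz : ∀ v ∈ V, n v = 0 → m v = 0 := fun v hv hnv => LinearMap.mem_ker.1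
    (hmS (Submodule.mem_sup_left (Submodule.subset_span ⟨hv, hnv⟩)))
  -- Ratio test: moving from `n` in the direction `m`, the first generator to reach zero is `v₂`.
  -- Generators already at zero stay there, and `v₀` keeps its value because `m v₀ = 0`.
  obtain ⟨v₂, hv₂, hmin⟩ := (V.filter fun v => m v < 0).exists_min_image
    (fun v => n v / (-m v)) ⟨v₁, by simp [hv₁, hm]⟩
  simp only [Finset.mem_filter] at hv₂ hmin
  have hnv₂ : n v₂ ≠ 0 := fun h => hv₂.2.ne (hmz _ hv₂.1 h)
  set t := n v₂ / (-m v₂) with ht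
  have ht0 : 0 ≤ t := div_nonneg (hn _ hv₂.1) (by linarith [hv₂.2])
  refine ⟨n + t • m, fun v hv => ?_, by simp [hm0, hnv₀], ?_⟩
  · simp only [LinearMap.add_apply, LinearMap.smul_apply, smul_eq_mul]
    rcases lt_or_ge (m v) 0 with h | h
    · have := hmin v ⟨hv, h⟩
      rw [le_div_iff₀ (by linarith)] at this
      linarith
    · have := hn v hv
      positivity
  · refine finrank_span_lt_of_mem (n := n) (w := v₂) ?_ (fun v hv => hv.2) ⟨hv₂.1, ?_⟩ hnv₂
    · rintro v ⟨hv, hnv⟩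
      exact ⟨hv, by simp [hnv, hmz v hv hnv]⟩
    · have := hv₂.2.ne
      simp only [LinearMap.add_apply, LinearMap.smul_apply, smul_eq_mul, ht]
      field_simp
      ring

/-- A pointed finitely generated cone has a facet. -/
theorem exists_facet (V : Finset W) (c : Dual ℝ W) (hc : ∀ v ∈ V, 0 < c v) {k : ℕ}
    (hk : finrank ℝ (Submodule.span ℝ (V : Set W)) = k + 1) :
    ∃ n : Dual ℝ W, (∀ v ∈ V, 0 ≤ n v) ∧ (∃ v ∈ V, 0 < n v) ∧
      finrank ℝ (Submodule.span ℝ {v | v ∈ V ∧ n v = 0}) = k := by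
  have key : ∀ j ≤ k, ∃ n : Dual ℝ W, (∀ v ∈ V, 0 ≤ n v) ∧ (∃ v ∈ V, 0 < n v) ∧
      j ≤ finrank ℝ (Submodule.span ℝ {v | v ∈ V ∧ n v = 0}) := by
    intro j
    induction j with
    | zero =>
      intro _
      obtain ⟨v, hv⟩ : V.Nonempty := by
        rw [Finset.nonempty_iff_ne_empty]
        rintro rfl
        rw [Finset.coe_empty, Submodule.span_empty, finrank_bot] at hk
        omega
      exact ⟨c, fun v hv => (hc v hv).le, ⟨v, hv, hc v hv⟩, Nat.zero_le _⟩
    | succ j ih =>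
      intro hj
      obtain ⟨n, hn, ⟨v, hv, hnv⟩, hjn⟩ := ih (by omega)
      by_cases h : j + 1 ≤ finrank ℝ (Submodule.span ℝ {v | v ∈ V ∧ n v = 0})
      · exact ⟨n, hn, ⟨v, hv, hnv⟩, h⟩
      · obtain ⟨n', h1, h2, h3⟩ := exists_tilt V hn hnv (by omega)
        exact ⟨n', h1, ⟨v, hv, h2⟩, by omega⟩
  obtain ⟨n, hn, ⟨v, hv, hnv⟩, hkn⟩ := key k le_rfl
  refine ⟨n, hn, ⟨v, hv, hnv⟩, ?_⟩
  have := finrank_span_lt_of_mem (A := {v | v ∈ V ∧ n v = 0}) (B := (V : Set W))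
    (fun v hv => hv.1) (n := n) (fun v hv => hv.2) hv hnv.ne'
  omega

/-- The functional vanishing on a facet is unique up to scaling. -/
theorem eq_zero_of_vanishing_on_facet {V : Finset W} {k : ℕ}
    (hk : finrank ℝ (Submodule.span ℝ (V : Set W)) = k + 1) {n n₀ : Dual ℝ W}
    (hn₀ : finrank ℝ (Submodule.span ℝ {v | v ∈ V ∧ n₀ v = 0}) = k)
    (hn : ∃ v ∈ V, n v ≠ 0) (hz : ∀ v ∈ V, n₀ v = 0 → n v = 0) {v : W} (hv : v ∈ V)
    (hnv : n v = 0) : n₀ v = 0 := by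
  by_contra h
  obtain ⟨w, hw, hnw⟩ := hn
  have h1 := finrank_span_lt_of_mem (A := {v | v ∈ V ∧ n₀ v = 0}) (B := {v | v ∈ V ∧ n v = 0})
    (fun v hv => ⟨hv.1, hz v hv.1 hv.2⟩) (n := n₀) (fun v hv => hv.2) ⟨hv, hnv⟩ h
  have h2 := finrank_span_lt_of_mem (A := {v | v ∈ V ∧ n v = 0}) (B := (V : Set W))
    (fun v hv => hv.1) (n := n) (fun v hv => hv.2) hw hnw
  omega

/-- `x` is a linear combination of `V` with positive coefficients. -/
def IsPosComb (V : Finset W) (x : W) : Prop :=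
  ∃ w : W → ℝ, (∀ v ∈ V, 0 < w v) ∧ x = ∑ v ∈ V, w v • v

omit [FiniteDimensional ℝ W] in
theorem IsPosComb.map_pos {V : Finset W} {x : W} (hx : IsPosComb V x) (hV : V.Nonempty)
    {c : Dual ℝ W} (hc : ∀ v ∈ V, 0 < c v) : 0 < c x := by
  obtain ⟨w, hw, rfl⟩ := hx
  simp only [map_sum, map_smul, smul_eq_mul]
  exact Finset.sum_pos (fun v hv => mul_pos (hw v hv) (hc v hv)) hV

omit [FiniteDimensional ℝ W] in
theorem IsPosComb.map_eq_zero {V : Finset W} {x : W} (hx : IsPosComb V x)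
    {c : Dual ℝ W} (hc : ∀ v ∈ V, c v = 0) : c x = 0 := by
  obtain ⟨w, hw, rfl⟩ := hx
  simp only [map_sum, map_smul, smul_eq_mul]
  exact Finset.sum_eq_zero fun v hv => by simp [hc v hv]

omit [FiniteDimensional ℝ W] in
theorem IsPosComb.smul {V : Finset W} {x : W} (hx : IsPosComb V x) {t : ℝ} (ht : 0 < t) :
    IsPosComb V (t • x) := by
  obtain ⟨w, hw, rfl⟩ := hx
  exact ⟨fun v => t * w v, fun v hv => mul_pos ht (hw v hv), by
    simp only [Finset.smul_sum, mul_smul]⟩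

omit [FiniteDimensional ℝ W] in
theorem IsPosComb.map_nonneg {V : Finset W} {x : W} (hx : IsPosComb V x)
    {n : Dual ℝ W} (hn : ∀ v ∈ V, 0 ≤ n v) : 0 ≤ n x := by
  obtain ⟨w, hw, rfl⟩ := hx
  simp only [map_sum, map_smul, smul_eq_mul]
  exact Finset.sum_nonneg fun v hv => mul_nonneg (hw v hv).le (hn v hv)

omit [FiniteDimensional ℝ W] in
theorem IsPosComb.eq_zero_of_map_eq_zero {V : Finset W} {x : W} (hx : IsPosComb V x)
    {n : Dual ℝ W} (hn : ∀ v ∈ V, 0 ≤ n v) (h0 : n x = 0) {v : W} (hv : v ∈ V) : n v = 0 := by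
  obtain ⟨w, hw, rfl⟩ := hx
  simp only [map_sum, map_smul, smul_eq_mul] at h0
  have := (Finset.sum_eq_zero_iff_of_nonneg fun v hv => mul_nonneg (hw v hv).le (hn v hv)).1 h0 v hv
  exact (mul_eq_zero.1 this).resolve_left (hw v hv).ne'

omit [FiniteDimensional ℝ W] in
theorem IsPosComb.filter_add {V : Finset W} {p : W → Prop} [DecidablePred p] {x : W}
    (hx : IsPosComb (V.filter p) x) {ε : ℝ} (hε : 0 < ε) :
    IsPosComb V (x + ε • ∑ v ∈ V, v) := by
  obtain ⟨w, hw, rfl⟩ := hx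
  refine ⟨fun v => (if p v then w v else 0) + ε, fun v hv => ?_, ?_⟩
  · by_cases h : p v
    · simpa [h] using add_pos (hw v (by simp [hv, h])) hε
    · simpa [h] using hε
  · simp only [add_smul, Finset.sum_add_distrib, Finset.sum_filter, Finset.smul_sum, ite_smul,
      zero_smul]

/-- Non-proportionality is demanded on `V` and includes `r = 0`, so that it passes through the
induction and later yields both distinct half-spaces and, once there are two indices, nonzero
normals. -/
theorem exists_functionals (k : ℕ) : ∀ (V : Finset W) (c : Dual ℝ W), (∀ v ∈ V, 0 < c v) →
    finrank ℝ (Submodule.span ℝ (V : Set W)) = k + 1 →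
    ∃ x, IsPosComb V x ∧ ∃ f : Fin (k + 1) → Dual ℝ W, (∀ i, f i x = 0) ∧
      (∀ i j, i ≠ j → ∀ r : ℝ, 0 ≤ r → ∃ v ∈ V, f i v ≠ r * f j v) ∧
      ∀ n : Dual ℝ W, (∀ v ∈ V, 0 ≤ n v) → (∃ v ∈ V, n v ≠ 0) →
        ∃ i, ∀ v ∈ V, n v = 0 → 0 < f i v := by
  induction k with
  | zero =>
    intro V c hc hk
    -- The cone is a ray, so `n` vanishes at no generator and even the zero functional serves.
    refine ⟨∑ v ∈ V, v, ⟨fun _ => 1, by simp, by simp⟩, fun _ => 0, by simp, fun i j h => ?_, ?_⟩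
    · exact (h (Subsingleton.elim (α := Fin 1) i j)).elim
    · rintro n hn ⟨w, hw, hnw⟩
      refine ⟨0, fun v hv hnv => ?_⟩
      have h1 := finrank_span_lt_of_mem (A := ∅) (B := {v | v ∈ V ∧ n v = 0})
        (by simp) (n := c) (by simp) ⟨hv, hnv⟩ (hc v hv).ne'
      have h2 := finrank_span_lt_of_mem (A := {v | v ∈ V ∧ n v = 0}) (B := (V : Set W))
        (fun v hv => hv.1) (n := n) (fun v hv => hv.2) hw hnw
      omega
  | succ k ih =>
    intro V c hc hk
    obtain ⟨n₀, hn₀, ⟨v₀, hv₀, hnv₀⟩, hfin⟩ := exists_facet V c hc hk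
    set U := V.filter fun v => n₀ v = 0 with hU
    have hUV : ∀ v ∈ U, v ∈ V := fun v hv => (Finset.mem_filter.1 hv).1
    have hU0 : ∀ v ∈ U, n₀ v = 0 := fun v hv => (Finset.mem_filter.1 hv).2
    have hUk : finrank ℝ (Submodule.span ℝ (U : Set W)) = k + 1 := by
      have : (U : Set W) = {v | v ∈ V ∧ n₀ v = 0} := by ext v; simp [hU]
      rw [this, hfin]
    have hUne : U.Nonempty := by
      rw [Finset.nonempty_iff_ne_empty]
      intro h
      rw [h, Finset.coe_empty, Submodule.span_empty, finrank_bot] at hUk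
      omega
    obtain ⟨x', hx', f', hf'x, hf'ne, hf'⟩ := ih U c (fun v hv => hc v (hUV v hv)) hUk
    have hcx' : 0 < c x' := hx'.map_pos hUne fun v hv => hc v (hUV v hv)
    have hnx' : n₀ x' = 0 := hx'.map_eq_zero hU0
    set z := ∑ v ∈ V, v with hz
    have hcz : 0 < c z := by
      rw [hz, map_sum]; exact Finset.sum_pos hc ⟨v₀, hv₀⟩
    have hnz : 0 < n₀ z := by
      rw [hz, map_sum]; exact Finset.sum_pos' hn₀ ⟨v₀, hv₀, hnv₀⟩
    have big : ∀ a b : ℝ, 0 < b → ∀ᶠ M : ℝ in atTop, 0 < a + M * b := fun a b hb =>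
      (tendsto_atTop_add_const_left _ a (tendsto_id.atTop_mul_const hb)).eventually_gt_atTop 0
    -- The first condition gives positivity off the facet; the second makes each `δ i ε` positive,
    -- which is needed to tell the functionals apart.
    obtain ⟨M, hM, hMz⟩ : ∃ M : ℝ, (∀ i, ∀ v ∈ V, 0 < n₀ v → 0 < f' i v + M * n₀ v) ∧
        ∀ i, 0 < f' i z + M * n₀ z := by
      refine Eventually.exists (f := atTop) (Eventually.and ?_ ?_)
      · refine eventually_all.2 fun i => (Finset.eventually_all V).2 fun v _ => ?_
        by_cases h : 0 < n₀ v
        · filter_upwards [big (f' i v) _ h] with M hM _ using hM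
        · exact Eventually.of_forall fun M h' => (h h').elim
      · exact eventually_all.2 fun i => big _ _ hnz
    set g : Fin (k + 1) → Dual ℝ W := fun i => f' i + M • n₀ with hg
    have hgz : ∀ i, 0 < g i z := fun i => by simpa [hg] using hMz i
    have hgx' : ∀ i, g i x' = 0 := fun i => by simp [hg, hnx', hf'x]
    have hgU : ∀ i, ∀ v ∈ U, g i v = f' i v := fun i v hv => by simp [hg, hU0 v hv]
    -- `δ i ε` is the multiple of `c` to subtract so that `g i - δ i ε • c` vanishes at `x' + ε •
    -- z`; it tends to 0 with `ε`.
    set δ : Fin (k + 1) → ℝ → ℝ := fun i ε => ε * g i z / (c x' + ε * c z) with hδ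
    have hδ0 : ∀ i, Tendsto (δ i) (𝓝[>] 0) (𝓝 0) := fun i => by
      have : ContinuousAt (δ i) 0 := by
        apply ContinuousAt.div
        · fun_prop
        · fun_prop
        · simpa using hcx'.ne'
      have h2 := this.tendsto
      simp only [hδ, zero_mul, zero_div] at h2
      exact h2.mono_left nhdsWithin_le_nhds
    obtain ⟨ε, hεδ, hε⟩ : ∃ ε : ℝ, (∀ i, ∀ v ∈ V, 0 < g i v → δ i ε * c v < g i v) ∧ 0 < ε := by
      refine Eventually.exists (f := 𝓝[>] (0 : ℝ)) (Eventually.and ?_ self_mem_nhdsWithin)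
      refine eventually_all.2 fun i => (Finset.eventually_all V).2 fun v _ => ?_
      by_cases h : 0 < g i v
      · have := (hδ0 i).mul_const (c v)
        rw [zero_mul] at this
        filter_upwards [this.eventually_lt_const h] with ε hε _ using hε
      · exact Eventually.of_forall fun M h' => (h h').elim
    set x := x' + ε • z with hx
    have hcx : c x = c x' + ε * c z := by simp [hx]
    have hcxpos : 0 < c x := by rw [hcx]; positivity
    have hnx : n₀ x = ε * n₀ z := by simp [hx, hnx']
    have hδpos : ∀ i, 0 < δ i ε := fun i => by
      have := hgz i
      simp only [hδ]
      positivity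
    set h₀ : Dual ℝ W := c - (c x / n₀ x) • n₀ with hh₀
    set h : Fin (k + 1) → Dual ℝ W := fun i => g i - δ i ε • c with hh
    have hh₀U : ∀ v ∈ U, h₀ v = c v := fun v hv => by simp [hh₀, hU0 v hv]
    have hh₀x' : h₀ x' = c x' := by simp [hh₀, hnx']
    have hhx' : ∀ i, h i x' = - (δ i ε * c x') := fun i => by simp [hh, hgx']
    -- A relation between two functionals on `U` persists at `x'`.
    have rel : ∀ (a b : Dual ℝ W) (r : ℝ), (∀ v ∈ V, a v = r * b v) → a x' = r * b x' := by
      intro a b r hab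
      have := hx'.map_eq_zero (c := a - r • b) fun v hv => by simp [hab v (hUV v hv)]
      simpa [sub_eq_zero] using this
    refine ⟨x, hx'.filter_add hε, Fin.cons h₀ h, ?_, ?_, ?_⟩
    · intro i
      refine Fin.cases ?_ (fun i => ?_) i
      · have : n₀ x ≠ 0 := by rw [hnx]; positivity
        simp [hh₀, this]
      · have h1 : g i x = ε * g i z := by simp [hx, hgx']
        have : c x' + ε * c z ≠ 0 := by rw [← hcx]; exact hcxpos.ne'
        simp only [Fin.cons_succ, hh, LinearMap.sub_apply, LinearMap.smul_apply, smul_eq_mul,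
          h1, hcx, hδ]
        field_simp
        ring
    · intro i j hij r hr
      by_contra! hcon
      -- The point `x'` separates the cases: `h₀` is positive there and every `h i` negative. If `h
      -- i = r * h j` on `V`, evaluation at `x'` gives `δ i ε = r * δ j ε`, so the terms in `c`
      -- cancel and `f' i = r * f' j` on `U`, against the induction hypothesis.
      have hrel := rel _ _ _ hcon
      revert hij hcon hrel
      refine Fin.cases ?_ (fun i => ?_) i <;> refine Fin.cases ?_ (fun j => ?_) j <;>
        intro hij hcon hrel
      · exact hij rfl
      · simp only [Fin.cons_zero, Fin.cons_succ, hh₀x', hhx'] at hrel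
        have : 0 ≤ r * (δ j ε * c x') := mul_nonneg hr (mul_pos (hδpos j) hcx').le
        linarith
      · simp only [Fin.cons_zero, Fin.cons_succ, hh₀x', hhx'] at hrel
        have h1 : 0 ≤ r * c x' := mul_nonneg hr hcx'.le
        have h2 := mul_pos (hδpos i) hcx'
        linarith
      · simp only [Fin.cons_succ, hhx'] at hrel hcon
        have hδij : δ i ε = r * δ j ε := by
          apply mul_right_cancel₀ hcx'.ne'
          linarith
        obtain ⟨v, hv, hne⟩ := hf'ne i j (fun h => hij (by rw [h])) r hr
        apply hne
        have := hcon v (hUV v hv)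
        simp only [hh, LinearMap.sub_apply, LinearMap.smul_apply, smul_eq_mul, hgU _ v hv,
          hδij] at this
        linarith
    · intro n hn hne
      -- Either `n` vanishes on the whole facet, and then its face is the facet itself, or it cuts
      -- out a proper face of the facet.
      by_cases hcase : ∀ v ∈ V, n₀ v = 0 → n v = 0
      · refine ⟨0, fun v hv hnv => ?_⟩
        have := eq_zero_of_vanishing_on_facet hk hfin hne hcase hv hnv
        rw [Fin.cons_zero, hh₀U v (by simp [hU, hv, this])]
        exact hc v hv
      · push Not at hcase
        obtain ⟨v₁, hv₁, hn₀v₁, hnv₁⟩ := hcase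
        obtain ⟨i, hi⟩ := hf' n (fun v hv => hn v (hUV v hv)) ⟨v₁, by simp [hU, hv₁, hn₀v₁], hnv₁⟩
        refine ⟨i.succ, fun v hv hnv => ?_⟩
        have hgv : 0 < g i v := by
          rcases (hn₀ v hv).eq_or_lt with h0 | h0
          · have hvU : v ∈ U := by simp [hU, hv, ← h0]
            rw [hgU i v hvU]
            exact hi v hvU hnv
          · simpa [hg] using hM i v hv h0
        have := hεδ i v hv hgv
        simpa [hh] using this

/-- On the face cut out by `n`, the `i`-th functional agrees with one positive on all of `V`. -/
theorem exists_functionals_of_span_eq_top {k : ℕ} (V : Finset W) (c : Dual ℝ W)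
    (hc : ∀ v ∈ V, 0 < c v) (hV : Submodule.span ℝ (V : Set W) = ⊤) (hk : finrank ℝ W = k + 1) :
    ∃ x, IsPosComb V x ∧ ∃ f : Fin (k + 1) → Dual ℝ W, (∀ i, f i x = 0) ∧
      (∀ i j, i ≠ j → ∀ r : ℝ, 0 ≤ r → f i ≠ r • f j) ∧
      ∀ n : Dual ℝ W, (∀ v ∈ V, 0 ≤ n v) → n ≠ 0 →
        ∃ i, ∃ g : Dual ℝ W, (∀ v ∈ V, 0 < g v) ∧ ∀ y, n y = 0 → g y = f i y := by
  obtain ⟨x, hx, f, hfx, hne, hf⟩ := exists_functionals k V c hc (by rw [hV, finrank_top, hk])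
  refine ⟨x, hx, f, hfx, fun i j hij r hr h => ?_, fun n hn hn0 => ?_⟩
  · obtain ⟨v, -, hv⟩ := hne i j hij r hr
    exact hv (by rw [h]; rfl)
  · have : ∃ v ∈ V, n v ≠ 0 := by
      by_contra! h
      apply hn0
      have := span_le_ker_of_forall_eq_zero (V := (V : Set W)) h
      rwa [hV, top_le_iff, LinearMap.ker_eq_top] at this
    obtain ⟨i, hi⟩ := hf n hn this
    -- A large multiple of `n` repairs the sign at generators off the face and changes nothing on
    -- it.
    obtain ⟨M, hM⟩ : ∃ M : ℝ, ∀ v ∈ V, 0 < f i v + M * n v := by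
      refine Eventually.exists (f := atTop) ((Finset.eventually_all V).2 fun v hv => ?_)
      rcases (hn v hv).eq_or_lt with h0 | h0
      · exact Eventually.of_forall fun M => by simpa [← h0] using hi v hv h0.symm
      · exact (tendsto_atTop_add_const_left _ _
          (tendsto_id.atTop_mul_const h0)).eventually_gt_atTop 0
    exact ⟨i, f i + M • n, fun v hv => by simpa using hM v hv, fun y hy => by simp [hy]⟩

end Core

/-! ### Interior points and supporting functionals of convex sets. -/

section Separation

open Module Filter Topology

variable {E : Type*} [NormedAddCommGroup E] [NormedSpace ℝ E]

theorem linearMap_eq_zero_of_const {A : Set E} (hA : (interior A).Nonempty) {f : Dual ℝ E} {s : ℝ}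
    (hf : ∀ y ∈ A, f y = s) : f = 0 := by
  obtain ⟨p, hp⟩ := hA
  ext z
  have hcont : ContinuousAt (fun ε : ℝ => p + ε • z) 0 := by fun_prop
  have hev : ∀ᶠ ε : ℝ in 𝓝[>] 0, p + ε • z ∈ A := by
    apply Filter.Eventually.filter_mono nhdsWithin_le_nhds
    apply hcont.eventually_mem
    simpa using mem_interior_iff_mem_nhds.1 hp
  obtain ⟨ε, hε, hε0⟩ := (hev.and self_mem_nhdsWithin).exists
  have h1 := hf _ hε
  rw [map_add, map_smul, hf p (interior_subset hp), smul_eq_mul] at h1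
  have h2 : ε * f z = 0 := by linarith
  simpa using (mul_eq_zero.1 h2).resolve_left (ne_of_gt hε0)

theorem subset_closure_interior {A : Set E} (hA : Convex ℝ A) (hne : (interior A).Nonempty) :
    A ⊆ closure (interior A) := by
  rw [hA.closure_interior_eq_closure_of_nonempty_interior hne]
  exact subset_closure

/-- Otherwise Hahn-Banach separates `x` strictly from the interior, and the weak inequality extends
to `A` by closure. -/
theorem mem_interior_of_forall_le {A : Set E} (hA : Convex ℝ A) (hne : (interior A).Nonempty)
    {x : E} (h : ∀ f : E →L[ℝ] ℝ, (∀ y ∈ A, f y ≤ f x) → f = 0) : x ∈ interior A := by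
  by_contra hx
  obtain ⟨f, hf⟩ := geometric_hahn_banach_open_point hA.interior isOpen_interior hx
  have hle : ∀ y ∈ A, f y ≤ f x := fun y hy =>
    closure_minimal (s := interior A) (t := {y | f y ≤ f x}) (fun y hy => (hf y hy).le)
      (isClosed_le f.continuous continuous_const) (subset_closure_interior hA hne hy)
  obtain ⟨p, hp⟩ := hne
  simpa [h f hle] using hf p hp

/-- When `F ⊆ A` the two bounds force `f = s` on `F`, so a nonempty proper face lies in a supporting
hyperplane. -/
theorem exists_le_of_disjoint_interior {A F : Set E} (hA : Convex ℝ A)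
    (hne : (interior A).Nonempty) (hF : Convex ℝ F) (hFne : F.Nonempty)
    (hdisj : Disjoint (interior A) F) :
    ∃ (f : E →L[ℝ] ℝ) (s : ℝ), f ≠ 0 ∧ (∀ y ∈ A, f y ≤ s) ∧ ∀ y ∈ F, s ≤ f y := by
  obtain ⟨f, s, hf, hs⟩ := geometric_hahn_banach_open hA.interior isOpen_interior hF hdisj
  refine ⟨f, s, ?_, fun y hy => ?_, hs⟩
  · rintro rfl
    obtain ⟨p, hp⟩ := hne
    obtain ⟨q, hq⟩ := hFne
    simpa using (hf p hp).trans_le (hs q hq)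
  · exact closure_minimal (s := interior A) (t := {y | f y ≤ s}) (fun y hy => (hf y hy).le)
      (isClosed_le f.continuous continuous_const) (subset_closure_interior hA hne hy)

/-- A convex set with a point in the interior can be prolonged beyond that point. -/
theorem exists_mem_openSegment_of_mem_interior {A : Set E} {p : E} (hp : p ∈ interior A) (q : E) :
    ∃ q' ∈ A, p ∈ openSegment ℝ q q' := by
  have hcont : ContinuousAt (fun ε : ℝ => p + ε • (p - q)) 0 := by fun_prop
  have hev : ∀ᶠ ε : ℝ in 𝓝[>] 0, p + ε • (p - q) ∈ A := by
    apply Filter.Eventually.filter_mono nhdsWithin_le_nhds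
    apply hcont.eventually_mem
    simpa using mem_interior_iff_mem_nhds.1 hp
  obtain ⟨ε, hε, hε0⟩ := (hev.and self_mem_nhdsWithin).exists
  have hε0 : 0 < ε := hε0
  refine ⟨_, hε, ε / (1 + ε), 1 / (1 + ε), by positivity, by positivity, by field_simp; ring, ?_⟩
  match_scalars <;> field_simp
  ring

end Separation

/-! ### Normal vectors and boundaries of half-spaces. -/

section InnerProduct

open Module Filter Topology

variable {E : Type*} [NormedAddCommGroup E] [InnerProductSpace ℝ E]

theorem exists_inner_eq [FiniteDimensional ℝ E] (f : Dual ℝ E) : ∃ u : E, ∀ y, f y = inner ℝ u y :=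
  ⟨(InnerProductSpace.toDual ℝ E).symm (LinearMap.toContinuousLinearMap f), fun y => by
    rw [InnerProductSpace.toDual_symm_apply]; rfl⟩

/-- Nonzero vectors defining the same open half-space are positively proportional. -/
theorem eq_smul_of_inner_pos_iff {u v : E} (hu : u ≠ 0) (hv : v ≠ 0)
    (h : ∀ z, 0 < inner ℝ u z → 0 < inner ℝ v z) : u = (‖u‖ / ‖v‖) • v := by
  by_contra hne
  have hu' : 0 < ‖u‖ := norm_pos_iff.2 hu
  have hv' : 0 < ‖v‖ := norm_pos_iff.2 hv
  have hlt : inner ℝ u v < ‖u‖ * ‖v‖ := by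
    rw [inner_lt_norm_mul_iff_real]
    intro h1
    apply hne
    rw [div_eq_inv_mul, mul_smul, ← h1, inv_smul_smul₀ hv'.ne']
  have h1 : 0 < inner ℝ u (‖v‖ • u - ‖u‖ • v) := by
    rw [inner_sub_right, inner_smul_right, inner_smul_right, real_inner_self_eq_norm_sq]
    nlinarith
  have h2 := h _ h1
  rw [inner_sub_right, inner_smul_right, inner_smul_right, real_inner_self_eq_norm_sq,
    real_inner_comm] at h2
  nlinarith

theorem mem_frontier_halfspace {u x : E} {t : ℝ} (hu : u ≠ 0) (hx : inner ℝ u x = t) :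
    x ∈ frontier {y : E | t < inner ℝ u y} := by
  have ho : IsOpen {y : E | t < inner ℝ u y} := isOpen_lt (by fun_prop) (by fun_prop)
  rw [frontier, ho.interior_eq]
  refine ⟨?_, by simp [hx]⟩
  have hc : ContinuousAt (fun ε : ℝ => x + ε • u) 0 := by fun_prop
  have ht : Tendsto (fun ε : ℝ => x + ε • u) (𝓝[>] 0) (𝓝 x) := by
    simpa using hc.tendsto.mono_left nhdsWithin_le_nhds
  refine mem_closure_of_tendsto ht ?_
  filter_upwards [self_mem_nhdsWithin] with ε (hε : 0 < ε)
  have : 0 < ‖u‖ := norm_pos_iff.2 hu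
  simp only [inner_add_right, inner_smul_right, hx, real_inner_self_eq_norm_sq]
  have : 0 < ε * ‖u‖ ^ 2 := by positivity
  linarith

end InnerProduct

/-! ### Euclidean polytopes by homogenization. -/

section EuclideanCase

open Module

variable {d : ℕ}

/-- A proper face misses the interior. -/
theorem IsFace.disjoint_interior {P F : Set (Euc d)} (hF : IsFace P F) (hne : F ≠ P) :
    Disjoint (interior P) F := by
  rw [Set.disjoint_left]
  intro p hp hpF
  refine hne (hF.1.antisymm fun q hq => ?_)
  obtain ⟨q', hq', hpq⟩ := exists_mem_openSegment_of_mem_interior hp q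
  exact hF.2.2 q hq q' hq' ⟨p, hpq, hpF⟩ (left_mem_segment ℝ q q')

theorem exists_euclidean_halfspaces (hd : 0 < d) (P : Set (Euc d)) (hP : IsConvexPolytope P) :
    ∃ x ∈ interior P, ∃ H : Fin (d + 1) → Set (Euc d), Function.Injective H ∧
      (∀ i, IsOpenHalfspace (H i) ∧ x ∈ frontier (H i)) ∧
      (∀ F, IsExposedFace P F → ∃ i, F ⊆ H i) ∧
      (∀ F, IsFace P F → F ≠ P → ∃ i, F ⊆ H i) := by
  obtain ⟨⟨V₀, hV₀, hPV⟩, hint⟩ := hP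
  have hconv : Convex ℝ P := hPV ▸ convex_convexHull ℝ V₀
  have hVP : V₀ ⊆ P := hPV ▸ subset_convexHull ℝ V₀
  classical
  set V : Finset (Euc d × ℝ) := hV₀.toFinset.image fun v => (v, 1) with hV
  have memV : ∀ v : Euc d × ℝ, v ∈ V ↔ v.1 ∈ V₀ ∧ v.2 = 1 := by
    rintro ⟨v, t⟩
    simp [hV, eq_comm]
  have split : ∀ (f : Dual ℝ (Euc d × ℝ)) (y : Euc d) (t : ℝ),
      f (y, t) = (f ∘ₗ LinearMap.inl ℝ _ _) y + t * f (0, 1) := by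
    intro f y t
    have : ((y, t) : Euc d × ℝ) = LinearMap.inl ℝ _ _ y + t • (0, 1) := by simp
    rw [this, map_add, map_smul]; rfl
  -- Positivity on the vertices carries over to the polytope.
  have pos : ∀ g : Dual ℝ (Euc d × ℝ), (∀ v ∈ V, 0 < g v) → ∀ y ∈ P, 0 < g (y, 1) := by
    intro g hg
    have : P ⊆ {y | -g (0, 1) < (g ∘ₗ LinearMap.inl ℝ _ _) y} := by
      rw [hPV]
      refine convexHull_min (fun v hv => ?_) (convex_halfSpace_gt (LinearMap.isLinear _) _)
      have := hg (v, 1) ((memV _).2 ⟨hv, rfl⟩)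
      rw [split] at this
      simp only [Set.mem_ofPred_eq]
      linarith
    intro y hy
    have h1 := this hy
    simp only [Set.mem_ofPred_eq] at h1
    rw [split]
    linarith
  have vanish : ∀ n : Dual ℝ (Euc d × ℝ), (∀ v ∈ V, n v = 0) → n = 0 := by
    intro n hn
    have hc : ∀ y ∈ P, (n ∘ₗ LinearMap.inl ℝ _ _) y = -n (0, 1) := by
      have : P ⊆ {y | (n ∘ₗ LinearMap.inl ℝ _ _) y = -n (0, 1)} := by
        rw [hPV]
        refine convexHull_min (fun v hv => ?_) (convex_hyperplane (LinearMap.isLinear _) _)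
        have := hn (v, 1) ((memV _).2 ⟨hv, rfl⟩)
        rw [split] at this
        simp only [Set.mem_ofPred_eq]
        linarith
      exact this
    have h0 := linearMap_eq_zero_of_const hint hc
    obtain ⟨p, hp⟩ := hint
    have h1 := hc p (interior_subset hp)
    rw [h0] at h1
    refine LinearMap.ext fun ⟨y, t⟩ => ?_
    rw [split, h0]
    simp only [LinearMap.zero_apply] at h1 ⊢
    rw [show n (0, 1) = 0 by linarith]
    simp
  have hspan : Submodule.span ℝ (V : Set (Euc d × ℝ)) = ⊤ := by
    by_contra h
    obtain ⟨n, hn, hle⟩ := Submodule.exists_le_ker_of_lt_top _ (lt_top_iff_ne_top.2 h)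
    exact hn (vanish n fun v hv => LinearMap.mem_ker.1 (hle (Submodule.subset_span hv)))
  have hVpos : ∀ v ∈ V, 0 < LinearMap.snd ℝ (Euc d) ℝ v := fun v hv => by
    simp [((memV v).1 hv).2]
  have hVne : V.Nonempty := by
    rw [Finset.nonempty_iff_ne_empty]
    intro h
    have := vanish (LinearMap.snd ℝ (Euc d) ℝ) (by simp [h])
    simpa using LinearMap.congr_fun this (0, 1)
  obtain ⟨X, hX, f, hfX, hfne, hf⟩ := exists_functionals_of_span_eq_top (k := d) V
    (LinearMap.snd ℝ (Euc d) ℝ) hVpos hspan (by simp)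
  -- Rescale to height 1, which is possible because a positive combination of `V` has positive
  -- height.
  obtain ⟨x, hX, hfX⟩ : ∃ x : Euc d, IsPosComb V (x, 1) ∧ ∀ i, f i (x, 1) = 0 := by
    have hpos := hX.map_pos hVne hVpos
    have heq : X.2⁻¹ • X = (X.2⁻¹ • X.1, (1 : ℝ)) := by
      ext1
      · rfl
      · exact inv_mul_cancel₀ hpos.ne'
    refine ⟨X.2⁻¹ • X.1, heq ▸ hX.smul (inv_pos.2 hpos), fun i => ?_⟩
    rw [← heq, map_smul, hfX, smul_zero]
  choose u hu using fun i => exists_inner_eq (f i ∘ₗ LinearMap.inl ℝ _ _)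
  have hfu : ∀ i y, f i (y, 1) = inner ℝ (u i) y + f i (0, 1) := fun i y => by
    rw [split, hu, one_mul]
  have hux : ∀ i, inner ℝ (u i) x = -f i (0, 1) := fun i => by
    have := hfX i
    rw [hfu] at this
    linarith
  -- All `f i` vanish at `(x, 1)`, so the linear part determines the constant term.
  have hfeq : ∀ i j (r : ℝ), u i = r • u j → f i = r • f j := by
    intro i j r h
    refine LinearMap.ext fun ⟨y, t⟩ => ?_
    have h1 := hux i
    rw [h, inner_smul_left, hux j] at h1
    rw [LinearMap.smul_apply, split (f i), split (f j), hu, hu, h, inner_smul_left, smul_eq_mul]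
    simp only [conj_trivial] at h1 ⊢
    linear_combination t * h1
  have hu0 : ∀ i, u i ≠ 0 := by
    intro i h
    obtain ⟨j, hj⟩ : ∃ j : Fin (d + 1), j ≠ i := by
      have : Nontrivial (Fin (d + 1)) := Fin.nontrivial_iff_two_le.2 (by omega)
      exact exists_ne i
    exact hfne i j hj.symm 0 le_rfl (hfeq i j 0 (by simp [h]))
  have hface : ∀ (n : Dual ℝ (Euc d × ℝ)) (F : Set (Euc d)), n ≠ 0 → F ⊆ P →
      (∀ y ∈ P, 0 ≤ n (y, 1)) → (∀ y ∈ F, n (y, 1) = 0) →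
      ∃ i, F ⊆ {y | -f i (0, 1) < inner ℝ (u i) y} := by
    intro n F hn0 hFP hn hnF
    obtain ⟨i, g, hg, hgf⟩ := hf n (fun v hv => by
      obtain ⟨h1, h2⟩ := (memV v).1 hv
      have := hn v.1 (hVP h1)
      rwa [← h2] at this) hn0
    refine ⟨i, fun y hy => ?_⟩
    have h1 := pos g hg y (hFP hy)
    rw [hgf _ (hnF y hy), hfu] at h1
    simp only [Set.mem_ofPred_eq]
    linarith
  have hsupp : ∀ (w : Euc d →L[ℝ] ℝ) (t : ℝ) (F : Set (Euc d)), w ≠ 0 → F ⊆ P →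
      (∀ y ∈ P, w y ≤ t) → (∀ y ∈ F, w y = t) →
      ∃ i, F ⊆ {y | -f i (0, 1) < inner ℝ (u i) y} := by
    intro w t F hw hFP hP hF
    refine hface (t • LinearMap.snd ℝ _ _ - (w : Euc d →ₗ[ℝ] ℝ) ∘ₗ LinearMap.fst ℝ _ _) F ?_ hFP
      (fun y hy => by simpa using hP y hy) (fun y hy => by simp [hF y hy])
    intro h
    apply hw
    ext y
    simpa using LinearMap.congr_fun h (y, 0)
  refine ⟨x, ?_, fun i => {y | -f i (0, 1) < inner ℝ (u i) y}, ?_, ?_, ?_, ?_⟩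
  -- If `w` is maximal over `P` at `x`, then `n` is nonnegative on `V` and zero at a strictly
  -- positive combination of `V`, hence zero on `V`.
  · refine mem_interior_of_forall_le hconv hint fun w hw => ?_
    set n : Dual ℝ (Euc d × ℝ) :=
      w x • LinearMap.snd ℝ _ _ - (w : Euc d →ₗ[ℝ] ℝ) ∘ₗ LinearMap.fst ℝ _ _ with hn
    have h0 : n = 0 := vanish n fun v hv => hX.eq_zero_of_map_eq_zero (n := n) (fun v hv => by
      obtain ⟨h1, h2⟩ := (memV v).1 hv
      simpa [hn, h2] using hw v.1 (hVP h1)) (by simp [hn]) hv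
    ext y
    simpa [hn] using LinearMap.congr_fun h0 (y, 0)
  · intro i j hij
    by_contra hne
    refine hfne i j hne _ (by positivity) (hfeq i j _ (eq_smul_of_inner_pos_iff (hu0 i) (hu0 j) ?_))
    intro z hz
    have h1 : x + z ∈ {y | -f i (0, 1) < inner ℝ (u i) y} := by
      simp only [Set.mem_ofPred_eq, inner_add_right, hux]
      linarith
    have hij : {y | -f i (0, 1) < inner ℝ (u i) y} = {y | -f j (0, 1) < inner ℝ (u j) y} := hij
    rw [hij] at h1
    simp only [Set.mem_ofPred_eq, inner_add_right, hux] at h1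
    linarith
  · exact fun i => ⟨⟨u i, _, hu0 i, rfl⟩, mem_frontier_halfspace (hu0 i) (hux i)⟩
  · rintro F ⟨w, t, hw, hle, -, rfl⟩
    refine hsupp (innerSL ℝ w) t _ ?_ (fun y hy => hy.1) hle (fun y hy => hy.2)
    intro h
    apply hw
    simpa using congrArg (fun g : Euc d →L[ℝ] ℝ => g w) h
  · intro F hF hne
    rcases F.eq_empty_or_nonempty with rfl | hFne
    · exact ⟨0, Set.empty_subset _⟩
    · obtain ⟨w, s, hw, hle, hge⟩ := exists_le_of_disjoint_interior hconv hint hF.2.1 hFne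
        (hF.disjoint_interior hne)
      exact hsupp w s F hw hF.1 hle fun y hy => (hle y (hF.1 hy)).antisymm (hge y hy)

end EuclideanCase

/-! ### Spherical polytopes through the cones over them. -/

section SphericalCase

open Module Filter Topology

variable {d : ℕ}

/-- The cone spanned by a set of unit vectors, without its apex. -/
def coneOver (P : Set (Sph d)) : Set (Euc (d + 1)) :=
  {w | ∃ t : ℝ, 0 < t ∧ ∃ y ∈ P, w = t • (y : Euc (d + 1))}

theorem norm_coe_sph (y : Sph d) : ‖(y : Euc (d + 1))‖ = 1 := by simp

theorem exists_sph_eq_smul {w : Euc (d + 1)} (hw : w ≠ 0) :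
    ∃ y : Sph d, w = ‖w‖ • (y : Euc (d + 1)) :=
  ⟨⟨‖w‖⁻¹ • w, by simp [norm_smul, hw]⟩, by simp [smul_smul, hw]⟩

theorem coe_mem_coneOver {P : Set (Sph d)} {y : Sph d} (hy : y ∈ P) :
    (y : Euc (d + 1)) ∈ coneOver P := ⟨1, one_pos, y, hy, by simp⟩

theorem mem_of_coe_mem_coneOver {P : Set (Sph d)} {y : Sph d}
    (hy : (y : Euc (d + 1)) ∈ coneOver P) : y ∈ P := by
  obtain ⟨t, ht, z, hz, h⟩ := hy
  have h1 := congrArg norm h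
  rw [norm_smul, norm_coe_sph, norm_coe_sph, mul_one, Real.norm_of_nonneg ht.le] at h1
  rw [← h1, one_smul] at h
  rwa [Subtype.ext h]

theorem smul_mem_coneOver {P : Set (Sph d)} {w : Euc (d + 1)} (hw : w ∈ coneOver P) {s : ℝ}
    (hs : 0 < s) : s • w ∈ coneOver P := by
  obtain ⟨t, ht, y, hy, rfl⟩ := hw
  exact ⟨s * t, mul_pos hs ht, y, hy, by rw [mul_smul]⟩

theorem convex_coneOver {P : Set (Sph d)} (hP : SphericallyConvex P) : Convex ℝ (coneOver P) := by
  obtain ⟨⟨c, hc⟩, hseg⟩ := hP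
  rw [convex_iff_forall_pos]
  rintro _ ⟨t, ht, y, hy, rfl⟩ _ ⟨s, hs, z, hz, rfl⟩ a b ha hb -
  have hcy : 0 < inner ℝ (c : Euc (d + 1)) (y : Euc (d + 1)) := hc hy
  have hcz : 0 < inner ℝ (c : Euc (d + 1)) (z : Euc (d + 1)) := hc hz
  set w := a • t • (y : Euc (d + 1)) + b • s • (z : Euc (d + 1)) with hw
  have hw0 : w ≠ 0 := by
    intro h
    have h1 : inner ℝ (c : Euc (d + 1)) w = 0 := by rw [h, inner_zero_right]
    simp only [hw, inner_add_right, inner_smul_right] at h1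
    have := mul_pos ha (mul_pos ht hcy)
    have := mul_pos hb (mul_pos hs hcz)
    linarith
  obtain ⟨q, hq⟩ := exists_sph_eq_smul hw0
  have hn : 0 < ‖w‖ := norm_pos_iff.2 hw0
  refine ⟨‖w‖, hn, q, hseg y hy z hz ⟨‖w‖⁻¹ * (a * t), ‖w‖⁻¹ * (b * s), by positivity,
    by positivity, ?_⟩, hq⟩
  rw [mul_smul, mul_smul, mul_smul, mul_smul, ← smul_add, ← hw, eq_inv_smul_iff₀ hn.ne', ← hq]

theorem coe_mem_interior_coneOver {P : Set (Sph d)} {p : Sph d} (hp : p ∈ interior P) :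
    (p : Euc (d + 1)) ∈ interior (coneOver P) := by
  obtain ⟨O, hO, hOP⟩ := isOpen_induced_iff.1 (isOpen_interior (s := P))
  have hp0 : (p : Euc (d + 1)) ≠ 0 := by
    rw [← norm_pos_iff, norm_coe_sph]; exact one_pos
  have hpO : (p : Euc (d + 1)) ∈ O := by
    have : p ∈ Subtype.val ⁻¹' O := hOP ▸ hp
    exact this
  have hc : ContinuousAt (fun w : Euc (d + 1) => ‖w‖⁻¹ • w) p :=
    (continuousAt_id.norm.inv₀ (norm_ne_zero_iff.2 hp0)).smul continuousAt_id
  rw [mem_interior_iff_mem_nhds]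
  have hev : ∀ᶠ w : Euc (d + 1) in 𝓝 p, ‖w‖⁻¹ • w ∈ O :=
    hc.eventually_mem (by simpa using hO.mem_nhds hpO)
  filter_upwards [hev, isOpen_ne.mem_nhds hp0] with w hw hw0
  obtain ⟨q, hq⟩ := exists_sph_eq_smul hw0
  have hn : ‖w‖ ≠ 0 := norm_ne_zero_iff.2 hw0
  refine ⟨‖w‖, norm_pos_iff.2 hw0, q, interior_subset ?_, hq⟩
  rw [← hOP]
  have : ‖w‖⁻¹ • w = (q : Euc (d + 1)) := (inv_smul_eq_iff₀ hn).2 hq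
  rwa [this] at hw

theorem mem_interior_of_coe_mem {P : Set (Sph d)} {p : Sph d}
    (hp : (p : Euc (d + 1)) ∈ interior (coneOver P)) : p ∈ interior P := by
  refine mem_interior.2 ⟨Subtype.val ⁻¹' interior (coneOver P), fun y hy => ?_,
    isOpen_interior.preimage continuous_subtype_val, hp⟩
  exact mem_of_coe_mem_coneOver (interior_subset hy)

/-- Scaling a point with positive value to infinity would break any upper bound. -/
theorem nonpos_of_le_on_coneOver {P : Set (Sph d)} {f : Dual ℝ (Euc (d + 1))} {s : ℝ}
    (hf : ∀ w ∈ coneOver P, f w ≤ s) {w : Euc (d + 1)} (hw : w ∈ coneOver P) : f w ≤ 0 := by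
  by_contra! h
  obtain ⟨M, hM, hM0⟩ := ((tendsto_id.atTop_mul_const h).eventually_gt_atTop s |>.and
    (eventually_gt_atTop (0 : ℝ))).exists
  have := hf _ (smul_mem_coneOver hw hM0)
  rw [map_smul, smul_eq_mul] at this
  exact absurd hM (not_lt.2 this)

theorem nonneg_of_le_on_coneOver {P : Set (Sph d)} (hP : P.Nonempty) {f : Dual ℝ (Euc (d + 1))}
    {s : ℝ} (hf : ∀ w ∈ coneOver P, f w ≤ s) : 0 ≤ s := by
  obtain ⟨p, hp⟩ := hP
  have ht : Tendsto (fun ε : ℝ => ε * f p) (𝓝[>] 0) (𝓝 0) := by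
    have : ContinuousAt (fun ε : ℝ => ε * f p) 0 := by fun_prop
    simpa using this.tendsto.mono_left nhdsWithin_le_nhds
  refine le_of_tendsto ht ?_
  filter_upwards [self_mem_nhdsWithin] with ε (hε : 0 < ε)
  simpa using hf _ (smul_mem_coneOver (coe_mem_coneOver hp) hε)

theorem IsSphericalFace.disjoint_interior {P F : Set (Sph d)} (hF : IsSphericalFace P F)
    (hne : F ≠ P) : Disjoint (interior (coneOver P)) (coneOver F) := by
  rw [Set.disjoint_left]
  rintro p hp ⟨t, ht, y, hy, rfl⟩
  refine hne (hF.1.antisymm fun q hq => ?_)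
  obtain ⟨_, ⟨s, hs, r, hr, rfl⟩, a, b, ha, hb, -, h⟩ :=
    exists_mem_openSegment_of_mem_interior hp (q : Euc (d + 1))
  refine hF.2.2 q hq r hr ⟨y, ⟨t⁻¹ * a, t⁻¹ * (b * s), by positivity, by positivity, ?_⟩, hy⟩
    ⟨1, 0, zero_le_one, le_rfl, by simp⟩
  rw [mul_smul, mul_smul, mul_smul, ← smul_add, h, inv_smul_smul₀ ht.ne']

/-- Such sets are admissible in the intersection defining `sphericalHull`, so positivity of `g` on
the vertices passes to the polytope. The hemisphere rules out antipodal pairs. -/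
theorem sphericallyConvex_pos (c : Sph d) (g : Dual ℝ (Euc (d + 1))) :
    SphericallyConvex {y : Sph d | y ∈ openHemisphere c ∧ 0 < g y} := by
  refine ⟨⟨c, fun y hy => hy.1⟩, ?_⟩
  rintro p ⟨hp, hgp⟩ q ⟨hq, hgq⟩ y ⟨a, b, ha, hb, hy⟩
  have hp : 0 < inner ℝ (c : Euc (d + 1)) (p : Euc (d + 1)) := hp
  have hq : 0 < inner ℝ (c : Euc (d + 1)) (q : Euc (d + 1)) := hq
  have key : ∀ s t : ℝ, 0 < s → 0 < t → 0 < a * s + b * t := by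
    intro s t hs ht
    rcases ha.eq_or_lt with rfl | ha
    · rcases hb.eq_or_lt with rfl | hb
      -- Both coefficients cannot vanish, since `y` is a unit vector.
      · have h1 := norm_coe_sph y
        rw [hy] at h1
        simp at h1
      · positivity
    · positivity
  constructor
  · change 0 < inner ℝ (c : Euc (d + 1)) (y : Euc (d + 1))
    rw [hy, inner_add_right, inner_smul_right, inner_smul_right]
    exact key _ _ hp hq
  · rw [hy, map_add, map_smul, map_smul]
    exact key _ _ hgp hgq

theorem sphericallyConvex_zero (c : Sph d) (g : Dual ℝ (Euc (d + 1))) :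
    SphericallyConvex {y : Sph d | y ∈ openHemisphere c ∧ g y = 0} := by
  refine ⟨⟨c, fun y hy => hy.1⟩, ?_⟩
  rintro p ⟨hp, hgp⟩ q ⟨hq, hgq⟩ y hy
  refine ⟨((sphericallyConvex_pos c (innerₛₗ ℝ (c : Euc (d + 1)))).2 p ⟨hp, hp⟩ q ⟨hq, hq⟩ hy).1, ?_⟩
  obtain ⟨a, b, ha, hb, hy⟩ := hy
  rw [hy, map_add, map_smul, map_smul, hgp, hgq]
  simp

theorem mem_frontier_openHemisphere {c x : Sph d}
    (hx : inner ℝ (c : Euc (d + 1)) (x : Euc (d + 1)) = 0) :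
    x ∈ frontier (openHemisphere c) := by
  have ho : IsOpen (openHemisphere c) := by
    unfold openHemisphere
    exact isOpen_lt (by fun_prop) (by fun_prop)
  rw [frontier, ho.interior_eq]
  refine ⟨?_, by simp [openHemisphere, hx]⟩
  have hne : ∀ ε : ℝ, (x : Euc (d + 1)) + ε • (c : Euc (d + 1)) ≠ 0 := by
    intro ε h
    have h1 : inner ℝ (x : Euc (d + 1)) ((x : Euc (d + 1)) + ε • (c : Euc (d + 1))) = 0 := by
      rw [h, inner_zero_right]
    rw [inner_add_right, inner_smul_right, real_inner_comm (c : Euc (d + 1)), hx,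
      real_inner_self_eq_norm_sq, norm_coe_sph] at h1
    norm_num at h1
  set γ : ℝ → Sph d := fun ε => ⟨‖(x : Euc (d + 1)) + ε • (c : Euc (d + 1))‖⁻¹ •
    ((x : Euc (d + 1)) + ε • (c : Euc (d + 1))), by
      rw [mem_sphere_zero_iff_norm, norm_smul, norm_inv, norm_norm,
        inv_mul_cancel₀ (norm_ne_zero_iff.2 (hne ε))]⟩ with hγ
  have hc : Continuous γ := by
    have h1 : Continuous fun ε : ℝ => (x : Euc (d + 1)) + ε • (c : Euc (d + 1)) := by fun_prop
    exact ((h1.norm.inv₀ fun ε => norm_ne_zero_iff.2 (hne ε)).smul h1).subtype_mk _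
  have h0 : γ 0 = x := by
    apply Subtype.ext
    simp [hγ]
  have ht : Tendsto γ (𝓝[>] 0) (𝓝 x) := by
    have := (hc.tendsto 0).mono_left (nhdsWithin_le_nhds (s := Set.Ioi 0))
    rwa [h0] at this
  refine mem_closure_of_tendsto ht ?_
  filter_upwards [self_mem_nhdsWithin] with ε (hε : 0 < ε)
  change 0 < inner ℝ (c : Euc (d + 1)) (‖(x : Euc (d + 1)) + ε • (c : Euc (d + 1))‖⁻¹ •
    ((x : Euc (d + 1)) + ε • (c : Euc (d + 1))))
  rw [inner_smul_right, inner_add_right, inner_smul_right, hx, real_inner_self_eq_norm_sq,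
    norm_coe_sph]
  have := norm_pos_iff.2 (hne ε)
  positivity

theorem openHemisphere_injective : Function.Injective (openHemisphere (d := d)) := by
  have ne0 : ∀ c : Sph d, (c : Euc (d + 1)) ≠ 0 := fun c => by
    rw [← norm_pos_iff, norm_coe_sph]; exact one_pos
  intro a b hab
  apply Subtype.ext
  have := eq_smul_of_inner_pos_iff (ne0 a) (ne0 b) fun z hz => by
    have hz0 : z ≠ 0 := by
      rintro rfl
      simp at hz
    obtain ⟨y, hy⟩ := exists_sph_eq_smul hz0
    have hn := norm_pos_iff.2 hz0
    rw [hy, inner_smul_right] at hz ⊢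
    have h1 : y ∈ openHemisphere a := pos_of_mul_pos_right hz hn.le
    rw [hab] at h1
    exact mul_pos hn h1
  simpa [norm_coe_sph] using this

theorem exists_spherical_halfspaces (hd : 0 < d) (P : Set (Sph d))
    (hP : IsSphericalConvexPolytope P) :
    ∃ x ∈ interior P, ∃ H : Fin (d + 1) → Set (Sph d), Function.Injective H ∧
      (∀ i, (∃ c : Sph d, H i = openHemisphere c) ∧ x ∈ frontier (H i)) ∧
      (∀ F, IsSphericalExposedFace P F → ∃ i, F ⊆ H i) ∧
      (∀ F, IsSphericalFace P F → F ≠ P → ∃ i, F ⊆ H i) := by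
  obtain ⟨⟨-, hsc, hint⟩, V₀, hV₀, hPV⟩ := hP
  have hconv := convex_coneOver hsc
  obtain ⟨c₀, hc₀⟩ := hsc.1
  obtain ⟨p₀, hp₀⟩ := hint
  have hint : (interior (coneOver P)).Nonempty := ⟨_, coe_mem_interior_coneOver hp₀⟩
  have hVP : V₀ ⊆ P := hPV ▸ Set.subset_sInter fun C hC => hC.2
  have hull : ∀ C : Set (Sph d), SphericallyConvex C → V₀ ⊆ C → P ⊆ C := fun C hC hVC =>
    hPV ▸ Set.sInter_subset_of_mem ⟨hC, hVC⟩
  classical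
  set V : Finset (Euc (d + 1)) := hV₀.toFinset.image (↑) with hV
  have memV : ∀ v, v ∈ V ↔ ∃ y ∈ V₀, (y : Euc (d + 1)) = v := fun v => by simp [hV]
  have pos : ∀ g : Dual ℝ (Euc (d + 1)), (∀ v ∈ V, 0 < g v) → ∀ y ∈ P, 0 < g y := fun g hg y hy =>
    (hull _ (sphericallyConvex_pos c₀ g)
      (fun v hv => ⟨hc₀ (hVP hv), hg v ((memV v).2 ⟨v, hv, rfl⟩)⟩) hy).2
  have vanishP : ∀ n : Dual ℝ (Euc (d + 1)), (∀ y ∈ P, n y = 0) → n = 0 := by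
    refine fun n hn => linearMap_eq_zero_of_const hint (s := 0) ?_
    rintro _ ⟨t, -, y, hy, rfl⟩
    rw [map_smul, hn y hy, smul_zero]
  have vanish : ∀ n : Dual ℝ (Euc (d + 1)), (∀ v ∈ V, n v = 0) → n = 0 := fun n hn =>
    vanishP n fun y hy => (hull _ (sphericallyConvex_zero c₀ n)
      (fun v hv => ⟨hc₀ (hVP hv), hn v ((memV v).2 ⟨v, hv, rfl⟩)⟩) hy).2
  have hspan : Submodule.span ℝ (V : Set (Euc (d + 1))) = ⊤ := by
    by_contra h
    obtain ⟨n, hn, hle⟩ := Submodule.exists_le_ker_of_lt_top _ (lt_top_iff_ne_top.2 h)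
    exact hn (vanish n fun v hv => LinearMap.mem_ker.1 (hle (Submodule.subset_span hv)))
  have hVpos : ∀ v ∈ V, 0 < innerₛₗ ℝ (c₀ : Euc (d + 1)) v := fun v hv => by
    obtain ⟨y, hy, rfl⟩ := (memV v).1 hv
    exact hc₀ (hVP hy)
  have hVne : V.Nonempty := by
    rw [Finset.nonempty_iff_ne_empty]
    intro h
    have h1 := vanish (innerₛₗ ℝ (c₀ : Euc (d + 1))) (by simp [h])
    have h2 : 0 < innerₛₗ ℝ (c₀ : Euc (d + 1)) (p₀ : Euc (d + 1)) := hc₀ (interior_subset hp₀)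
    rw [h1] at h2
    simp at h2
  obtain ⟨X, hX, f, hfX, hfne, hf⟩ := exists_functionals_of_span_eq_top (k := d) V
    (innerₛₗ ℝ (c₀ : Euc (d + 1))) hVpos hspan (by simp)
  obtain ⟨x, hX, hfX⟩ : ∃ x : Sph d, IsPosComb V x ∧ ∀ i, f i x = 0 := by
    have hpos := hX.map_pos hVne hVpos
    have hX0 : X ≠ 0 := by
      rintro rfl
      simp at hpos
    obtain ⟨x, hx⟩ := exists_sph_eq_smul hX0
    have hn := norm_pos_iff.2 hX0
    have heq := (inv_smul_eq_iff₀ hn.ne').2 hx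
    refine ⟨x, heq ▸ hX.smul (inv_pos.2 hn), fun i => ?_⟩
    rw [← heq, map_smul, hfX, smul_zero]
  have hfc : ∀ i, ∃ (c : Sph d) (t : ℝ), 0 < t ∧ ∀ y, f i y = t * inner ℝ (c : Euc (d + 1)) y := by
    intro i
    obtain ⟨u, hu⟩ := exists_inner_eq (f i)
    have hu0 : u ≠ 0 := by
      rintro rfl
      -- A zero functional would be `0` times another one; a second index exists because `0 < d`.
      obtain ⟨j, hj⟩ : ∃ j : Fin (d + 1), j ≠ i := by
        have : Nontrivial (Fin (d + 1)) := Fin.nontrivial_iff_two_le.2 (by omega)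
        exact exists_ne i
      exact hfne i j hj.symm 0 le_rfl (LinearMap.ext fun y => by simp [hu])
    obtain ⟨c, hc⟩ := exists_sph_eq_smul hu0
    refine ⟨c, ‖u‖, norm_pos_iff.2 hu0, fun y => ?_⟩
    rw [hu]
    conv_lhs => rw [hc]
    rw [inner_smul_left, conj_trivial]
  choose c t ht hc using hfc
  have hface : ∀ (n : Dual ℝ (Euc (d + 1))) (F : Set (Sph d)), n ≠ 0 → F ⊆ P →
      (∀ y ∈ P, n y ≤ 0) → (∀ y ∈ F, n y = 0) → ∃ i, F ⊆ openHemisphere (c i) := by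
    intro n F hn0 hFP hn hnF
    obtain ⟨i, g, hg, hgf⟩ := hf (-n) (fun v hv => by
      obtain ⟨y, hy, rfl⟩ := (memV v).1 hv
      simpa using hn y (hVP hy)) (neg_ne_zero.2 hn0)
    refine ⟨i, fun y hy => ?_⟩
    have h1 := pos g hg y (hFP hy)
    rw [hgf _ (by simp [hnF y hy]), hc] at h1
    exact pos_of_mul_pos_right h1 (ht i).le
  refine ⟨x, mem_interior_of_coe_mem ?_, fun i => openHemisphere (c i), ?_, ?_, ?_, ?_⟩
  · refine mem_interior_of_forall_le hconv hint fun w hw => ?_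
    have hneg : ∀ v ∈ V, 0 ≤ (-(w : Euc (d + 1) →ₗ[ℝ] ℝ)) v := fun v hv => by
      obtain ⟨y, hy, rfl⟩ := (memV v).1 hv
      have := nonpos_of_le_on_coneOver (f := (w : Euc (d + 1) →ₗ[ℝ] ℝ)) hw
        (coe_mem_coneOver (hVP hy))
      simpa using this
    have h1 := nonneg_of_le_on_coneOver (f := (w : Euc (d + 1) →ₗ[ℝ] ℝ))
      ⟨p₀, interior_subset hp₀⟩ hw
    have h2 := hX.map_nonneg hneg
    have h3 : (-(w : Euc (d + 1) →ₗ[ℝ] ℝ)) x = 0 := by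
      simp only [LinearMap.neg_apply, ContinuousLinearMap.coe_coe] at h2 ⊢
      linarith
    have h0 := vanish _ fun v hv => hX.eq_zero_of_map_eq_zero hneg h3 hv
    ext y
    simpa using LinearMap.congr_fun h0 y
  · intro i j hij
    by_contra hne
    have hcij := openHemisphere_injective hij
    have hti := ht i
    have htj := ht j
    refine hfne i j hne (t i / t j) (by positivity) (LinearMap.ext fun y => ?_)
    rw [LinearMap.smul_apply, hc, hc, hcij, smul_eq_mul]
    field_simp
  · refine fun i => ⟨⟨c i, rfl⟩, mem_frontier_openHemisphere ?_⟩
    have := hfX i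
    rw [hc] at this
    exact (mul_eq_zero.1 this).resolve_left (ht i).ne'
  · rintro F ⟨a, hle, -, rfl⟩
    refine hface (innerₛₗ ℝ (a : Euc (d + 1))) _ ?_ (fun y hy => hy.1) hle (fun y hy => hy.2)
    intro h
    have := LinearMap.congr_fun h (a : Euc (d + 1))
    simp at this
  · intro F hF hne
    rcases F.eq_empty_or_nonempty with rfl | ⟨q, hq⟩
    · exact ⟨0, Set.empty_subset _⟩
    · obtain ⟨w, s, hw, hle, hge⟩ := exists_le_of_disjoint_interior hconv hint
        (convex_coneOver hF.2.1) ⟨_, coe_mem_coneOver hq⟩ (hF.disjoint_interior hne)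
      -- On a cone the bound `s` is nonnegative while `w` is nonpositive, so `w` vanishes on `F`.
      have h1 := nonneg_of_le_on_coneOver (f := (w : Euc (d + 1) →ₗ[ℝ] ℝ)) ⟨q, hF.1 hq⟩ hle
      refine hface (w : Euc (d + 1) →ₗ[ℝ] ℝ) F ?_ hF.1
        (fun y hy => nonpos_of_le_on_coneOver hle (coe_mem_coneOver hy)) (fun y hy => ?_)
      · intro h
        apply hw
        ext y
        simpa using LinearMap.congr_fun h y
      · exact (nonpos_of_le_on_coneOver hle (coe_mem_coneOver (hF.1 hy))).antisymm
          (h1.trans (hge _ (coe_mem_coneOver hy)))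

end SphericalCase

theorem mainTheorem6 (d : ℕ) (hd : 2 < d) :
    (∀ P : Set (Sph d), IsSphericalConvexPolytope P →
      ∃ x ∈ interior P, ∃ H : Fin (d + 1) → Set (Sph d),
        Function.Injective H ∧
        (∀ i, (∃ c : Sph d, H i = openHemisphere c) ∧ x ∈ frontier (H i)) ∧
        (∀ F, IsSphericalExposedFace P F → ∃ i, F ⊆ H i) ∧
        (∀ F, IsSphericalFace P F → F ≠ P → ∃ i, F ⊆ H i)) ∧
    (∀ P : Set (Euc d), IsConvexPolytope P →
      ∃ x ∈ interior P, ∃ H : Fin (d + 1) → Set (Euc d),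
        Function.Injective H ∧
        (∀ i, IsOpenHalfspace (H i) ∧ x ∈ frontier (H i)) ∧
        (∀ F, IsExposedFace P F → ∃ i, F ⊆ H i) ∧
        (∀ F, IsFace P F → F ≠ P → ∃ i, F ⊆ H i)) := by
  exact ⟨fun P hP => exists_spherical_halfspaces (by omega) P hP,
    fun P hP => exists_euclidean_halfspaces (by omega) P hP⟩
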